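/- Let $m,n,\Delta\ge 0$ be integers with $(m,n)\neq(0,1)$. All graphs are finite. An $(m,n)$-graph is a simple graph each of whose adjacencies is either an arc (an oriented adjacency) carrying one of $m$ arc labels or an (unoriented) edge carrying one of $n$ edge labels; forgetting orientations and labels gives its underlying graph. A homomorphism $f:G\to H$ of $(m,n)$-graphs is a vertex map such that for every arc (respectively edge) $uv$ of $G$, $f(u)f(v)$ is an arc (respectively edge) of $H$ with the same label. The $(m,n)$-chromatic number $\chi_{m,n}(G)$ is the least number of vertices of an $(m,n)$-graph $H$ to which $G$ admits a homomorphism. A relative clique of $G$ is a set $R\subseteq V(G)$ such that $f(u)\ne f(v)$ for all distinct $u,v\in R$ and every homomorphism $f$ of $G$ to any $(m,n)$-graph; an absolute clique is an $(m,n)$-graph $A$ with $\chi_{m,n}(A)=|V(A)|$. Let $\omega_{r(m,n)}(G)$ be the maximum size of a relative clique of $G$, and $\omega_{a(m,n)}(G)$ the maximum order of a subgraph of $G$ that is an absolute clique. Let $\mathcal G_\Delta$ be the family of simple graphs of maximum degree at most $\Delta$; write $\omega_{r(m,n)}(\mathcal G_\Delta)$ and $\omega_{a(m,n)}(\mathcal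 G_\Delta)$ for the maximum of $\omega_{r(m,n)}(G)$, respectively $\omega_{a(m,n)}(G)$, over all $(m,n)$-graphs $G$ whose underlying graph is in $\mathcal G_\Delta$. Let $\nu(2,\Delta)$ be the maximum number of vertices of a simple graph of diameter at most $2$ and maximum degree at most $\Delta$. Then $\omega_{r(m,n)}(\mathcal G_\Delta)\le\Delta^2+1$, and moreover: (i) if $\Delta<2m+n$, then $\nu(2,\Delta)=\omega_{a(m,n)}(\mathcal G_\Delta)\le\omega_{r(m,n)}(\mathcal G_\Delta)\le\Delta^2+1$; (ii) if $\Delta=2m+n$, then $\omega_{a(m,n)}(\mathcal G_\Delta)\le\omega_{r(m,n)}(\mathcal G_\Delta)\le\Delta^2+1$; (iii) if $\Delta>2m+n\ge 1$, then $\omega_{a(m,n)}(\mathcal G_\Delta)\le\omega_{r(m,n)}(\mathcal G_\Delta)\le\left\lfloor\frac{2m+n-1}{2m+n}\,\Delta^2\right\rfloor+\Delta+1$. -/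

import Mathlib

/-- The adjacency types of an `(m, n)`-colored mixed graph: for each of the `m` arc labels `k`,
the symbols `k` (forward) and `-k` (backward), and the `n` edge labels. -/
inductive AdjType (m n : ℕ) : Type
  | fwd (k : Fin m) : AdjType m n
  | bwd (k : Fin m) : AdjType m n
  | edge (k : Fin n) : AdjType m n

/-- The type of `vu` in terms of the type of `uv`: it is negated for arcs, unchanged for edges. -/
def AdjType.rev {m n : ℕ} : AdjType m n → AdjType m n
  | .fwd k => .bwd k
  | .bwd k => .fwd k
  | .edge k => .edge k

/-- An `(m, n)`-colored mixed graph on the vertex set `V` whose underlying graph is simple.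
`σ u v = some (fwd k)` : there is an arc from `u` to `v` with label `k`;
`σ u v = some (bwd k)` : there is an arc from `v` to `u` with label `k`;
`σ u v = some (edge k)` : there is an edge `uv` with label `k`;
`σ u v = none` : `u` and `v` are not adjacent. -/
@[ext]
structure MNGraph (m n : ℕ) (V : Type*) where
  σ : V → V → Option (AdjType m n)
  σ_self : ∀ v, σ v v = none
  σ_rev : ∀ u v, σ v u = (σ u v).map AdjType.rev

namespace MNGraph

universe u v

/-- The underlying simple graph. -/
def und {m n : ℕ} {V : Type u} (G : MNGraph m n V) : SimpleGraph V where
  Adj u v := G.σ u v ≠ none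
  symm := ⟨fun u v h => by
    rw [G.σ_rev u v]
    simpa using h⟩
  loopless := ⟨fun v h => h (G.σ_self v)⟩

/-- `f` is a homomorphism of `G` to `H`: it maps every arc or edge to an arc or edge of the same
label (and, for arcs, the same direction). -/
def IsHom {m n : ℕ} {V : Type u} {W : Type v} (G : MNGraph m n V) (H : MNGraph m n W)
    (f : V → W) : Prop :=
  ∀ u v a, G.σ u v = some a → H.σ (f u) (f v) = some a

/-- The `(m, n)`-chromatic number: the least order of an `(m, n)`-graph to which `G` has a
homomorphism. -/
noncomputable def chromaticNumber {m n : ℕ} {V : Type u} (G : MNGraph m n V) : ℕ∞ :=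
  ⨅ (W : Type u) (H : MNGraph m n W) (_ : ∃ f : V → W, G.IsHom H f), ENat.card W

/-- `R` is an `(m, n)`-relative clique of `G`: every homomorphism of `G` to any `(m, n)`-graph
has distinct values at distinct vertices of `R`. -/
def IsRelativeClique {m n : ℕ} {V : Type u} (G : MNGraph m n V) (R : Set V) : Prop :=
  ∀ (W : Type u) (H : MNGraph m n W) (f : V → W), G.IsHom H f →
    ∀ u ∈ R, ∀ v ∈ R, u ≠ v → f u ≠ f v

/-- The `(m, n)`-relative clique number of `G`. -/
noncomputable def relativeCliqueNumber {m n : ℕ} {V : Type u} (G : MNGraph m n V) : ℕ∞ :=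
  ⨆ (R : Set V) (_ : G.IsRelativeClique R), R.encard

/-- An `(m, n)`-absolute clique: the chromatic number equals the number of vertices. -/
def IsAbsoluteClique {m n : ℕ} {V : Type u} (A : MNGraph m n V) : Prop :=
  A.chromaticNumber = ENat.card V

/-- `A`, with vertex set `S`, is a (not necessarily induced) subgraph of `G`. -/
def IsSubgraph {m n : ℕ} {V : Type u} {S : Set V} (A : MNGraph m n S) (G : MNGraph m n V) : Prop :=
  ∀ (u v : S) (a : AdjType m n), A.σ u v = some a → G.σ u v = some a

/-- The `(m, n)`-absolute clique number of `G`: the largest order of a subgraph of `G` that is an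
`(m, n)`-absolute clique. -/
noncomputable def absoluteCliqueNumber {m n : ℕ} {V : Type u} (G : MNGraph m n V) : ℕ∞ :=
  ⨆ (S : Set V) (A : MNGraph m n S) (_ : A.IsSubgraph G) (_ : A.IsAbsoluteClique), S.encard

end MNGraph

/-- The family of the simple graphs in which every vertex has degree at most `Δ`. -/
def BoundedDegree (Δ : ℕ) (V : Type) (U : SimpleGraph V) : Prop :=
  ∀ v : V, (U.neighborSet v).encard ≤ (Δ : ℕ∞)

/-- The relative clique number of a family `F` of simple graphs: the maximum of the relative clique
numbers of the finite `(m, n)`-graphs whose underlying graph is in `F`. -/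
noncomputable def familyRelativeCliqueNumber (m n : ℕ)
    (F : (V : Type) → SimpleGraph V → Prop) : ℕ∞ :=
  ⨆ (V : Type) (_ : Finite V) (G : MNGraph m n V) (_ : F V G.und), G.relativeCliqueNumber

/-- The absolute clique number of a family `F` of simple graphs. -/
noncomputable def familyAbsoluteCliqueNumber (m n : ℕ)
    (F : (V : Type) → SimpleGraph V → Prop) : ℕ∞ :=
  ⨆ (V : Type) (_ : Finite V) (G : MNGraph m n V) (_ : F V G.und), G.absoluteCliqueNumber

/-- The degree-diameter value `ν(d, Δ)`: the largest number of vertices of a finite simple graph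
of diameter at most `d` (in particular, connected) and maximum degree at most `Δ`. -/
noncomputable def degreeDiameter (d Δ : ℕ) : ℕ∞ :=
  ⨆ (V : Type) (_ : Finite V) (U : SimpleGraph V) (_ : BoundedDegree Δ V U)
    (_ : U.ediam ≤ (d : ℕ∞)), ENat.card V

/-! A homomorphism can identify two distinct vertices unless they are adjacent or some common
neighbour sees them with different adjacency types. So relative cliques are the sets whose pairs are
`Distinguished` (`isRelativeClique_iff`), and a finite absolute clique is a graph whose whole vertex
set is one (`isAbsoluteClique_iff`). A relative clique therefore lies in a ball of radius two, of
size at most `1 + Δ + Δ(Δ - 1)`, and an absolute clique has diameter at most two.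

If `Δ < 2m + n`, every graph of diameter at most two and maximum degree at most `Δ` underlies an
absolute clique. Vizing's theorem colours its edges properly with the `2m + n` adjacency types. The
two colours belonging to one arc label form a bipartite graph, so they can be turned into consistent
arcs, one class pointing each way across the bipartition. All types at a vertex are then distinct
(`exists_und_eq_of_degree_lt`), so any two of its neighbours are distinguished.

The bound in (iii) counts ordered pairs in a relative clique `R`. At most `|R|Δ` are adjacent. With
`p = 2m + n`, a vertex having `d` neighbours in `R` separates at most `(1 - 1/p)d²` pairs. Since `d
≤ Δ` and the values of `d` sum to at most `|R|Δ`, all vertices together separate at most `(1 -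
1/p)Δ²|R|` pairs; dividing by `|R|` gives the bound. -/

section EdgeColoring

/-! ### Vizing's theorem by fans and Kempe chains. -/

open SimpleGraph

/-- In a graph of maximum degree at most two, three vertices of degree at most one do not lie in
one connected component. -/
theorem SimpleGraph.not_reachable_of_three_ends {V : Type*} [Finite V] (H : SimpleGraph V)
    (h2 : ∀ v, (H.neighborSet v).ncard ≤ 2) {u v w : V} (huv : u ≠ v) (huw : u ≠ w) (hvw : v ≠ w)
    (hu : (H.neighborSet u).ncard ≤ 1) (hv : (H.neighborSet v).ncard ≤ 1)
    (hw : (H.neighborSet w).ncard ≤ 1) (ruv : H.Reachable u v) (ruw : H.Reachable u w) : False := by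
  classical
  have := Fintype.ofFinite V
  let C := H.connectedComponentMk u
  have hconn : (H.induce C.supp).Connected := C.connected_toSimpleGraph
  -- A connected component on `N` vertices has degree sum at least `2N - 2`; three ends would force
  -- it down to `2N - 3`.
  have hcard := hconn.card_vert_le_card_edgeSet_add_one
  have hsum := (H.induce C.supp).sum_degrees_eq_twice_card_edges
  have hu' : u ∈ C.supp := rfl
  have hv' : v ∈ C.supp := ConnectedComponent.sound ruv.symm
  have hw' : w ∈ C.supp := ConnectedComponent.sound ruw.symm
  have hdeg : ∀ x : C.supp, (H.induce C.supp).degree x ≤ (H.neighborSet x).ncard := by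
    intro x
    rw [← card_neighborSet_eq_degree, ← Nat.card_eq_fintype_card, ← Nat.card_coe_set_eq]
    exact Nat.card_le_card_of_injective (fun y => ⟨y.1.1, y.2⟩)
      (fun a b h => by simpa [Subtype.ext_iff] using h)
  let T : Finset C.supp := {⟨u, hu'⟩, ⟨v, hv'⟩, ⟨w, hw'⟩}
  have hT : T.card = 3 := by
    rw [Finset.card_eq_three]
    exact ⟨_, _, _, by simpa using huv, by simpa using huw, by simpa using hvw, rfl⟩
  have hle : ∑ x : C.supp, ((H.induce C.supp).degree x + if x ∈ T then 1 else 0) ≤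
      ∑ _x : C.supp, 2 := by
    refine Finset.sum_le_sum fun x _ => ?_
    have h := hdeg x
    split_ifs with hx
    · simp only [T, Finset.mem_insert, Finset.mem_singleton] at hx
      rcases hx with rfl | rfl | rfl <;> simp only at h <;> omega
    · have := h2 x
      omega
  rw [Finset.sum_add_distrib, hsum, Finset.sum_ite_mem, Finset.univ_inter] at hle
  simp only [Finset.sum_const, hT, Finset.card_univ, smul_eq_mul] at hle
  rw [Nat.card_eq_fintype_card, Nat.card_eq_fintype_card, ← edgeFinset_card] at hcard
  omega

/-- A proper partial edge colouring: `c u v` is the colour of the edge `uv`, if it has one. -/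
structure IsPartialEdgeColoring {V C : Type*} (c : V → V → Option C) : Prop where
  symm : ∀ u v, c u v = c v u
  irrefl : ∀ v, c v v = none
  proper : ∀ u v w a, c u v = some a → c u w = some a → v = w

namespace IsPartialEdgeColoring

variable {V C : Type*} {c : V → V → Option C}

/-- The colour `a` does not occur at the vertex `v`. -/
def Missing (c : V → V → Option C) (a : C) (v : V) : Prop := ∀ w, c v w ≠ some a

/-- `c` with the colour of the edge `xy` replaced. -/
def recolor [DecidableEq V] (c : V → V → Option C) (x y : V) (o : Option C) : V → V → Option C :=
  fun u v => if (u = x ∧ v = y) ∨ (u = y ∧ v = x) then o else c u v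

/-- `c` with two colours exchanged on the edges at the vertices of `S`. -/
def swapOn [DecidableEq C] (c : V → V → Option C) (a b : C) (S : Set V)
    [DecidablePred (· ∈ S)] : V → V → Option C :=
  fun u v => if u ∈ S then (c u v).map (Equiv.swap a b) else c u v

/-- `c'` colours the edge `xy` in addition to the edges that `c` colours. -/
def Extends (c c' : V → V → Option C) (x y : V) : Prop :=
  ∀ u v, c' u v ≠ none ↔ (c u v ≠ none ∨ (u = x ∧ v = y) ∨ (u = y ∧ v = x))

theorem recolor_none [DecidableEq V] (hc : IsPartialEdgeColoring c) (x y : V) :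
    IsPartialEdgeColoring (recolor c x y none) := by
  constructor
  · intro u v
    simp only [recolor, hc.symm u v]
    congr 1
    simp only [eq_iff_iff]; tauto
  · intro v
    simp [recolor, hc.irrefl]
  · intro u v w a h1 h2
    simp only [recolor] at h1 h2
    split_ifs at h1 h2
    exact hc.proper u v w a h1 h2

theorem recolor_some [DecidableEq V] (hc : IsPartialEdgeColoring c) {x y : V} (hxy : x ≠ y) {a : C}
    (hx : Missing c a x) (hy : Missing c a y) :
    IsPartialEdgeColoring (recolor c x y (some a)) := by
  constructor
  · intro u v
    simp only [recolor, hc.symm u v]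
    congr 1
    simp only [eq_iff_iff]; tauto
  · intro v
    simp only [recolor, hc.irrefl]
    rw [if_neg]
    rintro (⟨rfl, h⟩ | ⟨rfl, h⟩)
    · exact hxy h
    · exact hxy h.symm
  · intro u v w b h1 h2
    simp only [recolor] at h1 h2
    split_ifs at h1 h2 with h3 h4 h4
    · rcases h3 with ⟨rfl, rfl⟩ | ⟨rfl, rfl⟩ <;> rcases h4 with ⟨h5, rfl⟩ | ⟨h5, rfl⟩
      all_goals first | rfl | exact absurd h5 hxy | exact absurd h5.symm hxy
    · rw [← h1] at h2
      rcases h3 with ⟨rfl, rfl⟩ | ⟨rfl, rfl⟩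
      · exact absurd h2 (hx _)
      · exact absurd h2 (hy _)
    · rw [← h2] at h1
      rcases h4 with ⟨rfl, rfl⟩ | ⟨rfl, rfl⟩
      · exact absurd h1 (hx _)
      · exact absurd h1 (hy _)
    · exact hc.proper u v w b h1 h2

/-- `S` is closed under the edges of the colours `a` and `b`. -/
def KempeClosed (c : V → V → Option C) (a b : C) (S : Set V) : Prop :=
  ∀ u v, (c u v = some a ∨ c u v = some b) → u ∈ S → v ∈ S

/-- An edge leaving `S` has neither colour, so the exchange fixes it and both ends agree on every
edge. Properness survives because each vertex sees its colours through one injection. -/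
theorem swapOn_isPartialEdgeColoring [DecidableEq C] (hc : IsPartialEdgeColoring c) {a b : C}
    {S : Set V} [DecidablePred (· ∈ S)] (hS : KempeClosed c a b S) :
    IsPartialEdgeColoring (swapOn c a b S) := by
  constructor
  · intro u v
    have h1 := hS u v
    have h2 := hS v u
    rw [hc.symm v u] at h2
    simp only [swapOn, hc.symm v u]
    rcases h : c u v with _ | e
    · simp
    · rw [h] at h1 h2
      by_cases hu : u ∈ S <;> by_cases hv : v ∈ S <;> simp only [hu, hv, if_true, if_false]
      all_goals
        have : e ≠ a ∧ e ≠ b := by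
          constructor <;> rintro rfl <;> simp_all
        simp [Equiv.swap_apply_of_ne_of_ne this.1 this.2]
  · intro v
    simp [swapOn, hc.irrefl]
  · intro u v w e h1 h2
    simp only [swapOn] at h1 h2
    split_ifs at h1 h2
    · simp only [Option.map_eq_some_iff] at h1 h2
      obtain ⟨p, hp, rfl⟩ := h1
      obtain ⟨q, hq, hqp⟩ := h2
      obtain rfl := (Equiv.swap a b).injective hqp
      exact hc.proper u v w _ hp hq
    · exact hc.proper u v w e h1 h2

theorem swapOn_ne_none [DecidableEq C] (a b : C) (S : Set V) [DecidablePred (· ∈ S)] (u v : V) :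
    swapOn c a b S u v ≠ none ↔ c u v ≠ none := by
  simp only [swapOn]
  split_ifs <;> simp

theorem missing_swapOn_of_mem [DecidableEq C] {a b e : C} {S : Set V} [DecidablePred (· ∈ S)]
    {v : V} (hv : v ∈ S) (h : Missing c e v) :
    Missing (swapOn c a b S) (Equiv.swap a b e) v := by
  intro w hw
  simp only [swapOn, hv, if_true, Option.map_eq_some_iff] at hw
  obtain ⟨p, hp, hpe⟩ := hw
  obtain rfl := (Equiv.swap a b).injective hpe
  exact h w hp

theorem missing_swapOn_of_mem_of_missing_right [DecidableEq C] {a b : C} {S : Set V}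
    [DecidablePred (· ∈ S)] {v : V} (hv : v ∈ S) (h : Missing c b v) :
    Missing (swapOn c a b S) a v := by
  simpa using missing_swapOn_of_mem (a := a) (b := b) hv h

theorem missing_swapOn_of_notMem [DecidableEq C] {a b e : C} {S : Set V} [DecidablePred (· ∈ S)]
    {v : V} (hv : v ∉ S) (h : Missing c e v) : Missing (swapOn c a b S) e v := by
  intro w hw
  simp only [swapOn, hv, if_false] at hw
  exact h w hw

/-- The graph of the edges that have colour `a` or `b`. -/
def kempeGraph (hc : IsPartialEdgeColoring c) (a b : C) : SimpleGraph V where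
  Adj u v := c u v = some a ∨ c u v = some b
  symm := ⟨fun u v h => by rwa [hc.symm v u]⟩
  loopless := ⟨fun v h => by simp [hc.irrefl] at h⟩

theorem kempeClosed_component (hc : IsPartialEdgeColoring c) (a b : C) (x : V) :
    KempeClosed c a b {v | (hc.kempeGraph a b).Reachable x v} :=
  fun u v h hu => Reachable.trans hu (Adj.reachable (show (hc.kempeGraph a b).Adj u v from h))

theorem ncard_color_le_one [Finite V] (hc : IsPartialEdgeColoring c) (a : C) (v : V) :
    {w | c v w = some a}.ncard ≤ 1 :=
  (Set.ncard_le_one_iff (Set.toFinite _)).2 fun h1 h2 => hc.proper v _ _ a h1 h2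

theorem ncard_kempeGraph_le_two [Finite V] (hc : IsPartialEdgeColoring c) (a b : C) (v : V) :
    ((hc.kempeGraph a b).neighborSet v).ncard ≤ 2 :=
  (Set.ncard_union_le {w | c v w = some a} {w | c v w = some b}).trans
    (Nat.add_le_add (hc.ncard_color_le_one a v) (hc.ncard_color_le_one b v))

theorem ncard_kempeGraph_le_one [Finite V] (hc : IsPartialEdgeColoring c) {a b : C} {v : V}
    (h : Missing c a v ∨ Missing c b v) : ((hc.kempeGraph a b).neighborSet v).ncard ≤ 1 := by
  rcases h with h | h
  · refine (Set.ncard_le_ncard ?_).trans (hc.ncard_color_le_one b v)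
    exact fun w hw => hw.resolve_left (h w)
  · refine (Set.ncard_le_ncard ?_).trans (hc.ncard_color_le_one a v)
    exact fun w hw => hw.resolve_right (h w)

/-- `y 0, …, y k` is a Vizing fan at `x`. -/
structure IsFan (c : V → V → Option C) (x : V) (y : ℕ → V) (k : ℕ) : Prop where
  inj : ∀ i j, i ≤ k → j ≤ k → y i = y j → i = j
  ne : x ≠ y 0
  uncolored : c x (y 0) = none
  missing : ∀ j < k, ∃ a, c x (y (j + 1)) = some a ∧ Missing c a (y j)

/-- A fan can be shifted by one step. -/
theorem IsFan.shift (hc : IsPartialEdgeColoring c) {x : V} {y : ℕ → V} {k : ℕ}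
    (hf : IsFan c x y (k + 1)) :
    ∃ c' : V → V → Option C, IsPartialEdgeColoring c' ∧ IsFan c' x (fun i => y (i + 1)) k ∧
      (∀ c'', Extends c' c'' x (y 1) → Extends c c'' x (y 0)) ∧
      (∀ e, Missing c e x → Missing c' e x) ∧
      (∀ j, 1 ≤ j → j ≤ k + 1 → ∀ e, Missing c e (y j) → Missing c' e (y j)) ∧
      (∀ j, 2 ≤ j → j ≤ k + 1 → c' x (y j) = c x (y j)) := by
  classical
  -- The colour of `x (y 1)` is missing at `y 0`, so it moves to `x (y 0)`. Only `y 0` gains a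
  -- colour, which is why the missing colours of the later vertices persist.
  obtain ⟨a, ha, ham⟩ := hf.missing 0 (by omega)
  have hx1 : x ≠ y 1 := by
    intro h
    simp only [zero_add, ← h, hc.irrefl] at ha
    simp at ha
  have h01 : y 0 ≠ y 1 := fun h => by simpa using hf.inj 0 1 (by omega) (by omega) h
  simp only [zero_add] at ha
  have hd := hc.recolor_none x (y 1)
  have hax : Missing (recolor c x (y 1) none) a x := by
    intro w hw
    simp only [recolor] at hw
    split_ifs at hw with h
    exact h (by simp [hc.proper x _ _ a hw ha])
  have hay : Missing (recolor c x (y 1) none) a (y 0) := by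
    intro w hw
    simp only [recolor] at hw
    split_ifs at hw with h
    exact ham w hw
  have key : ∀ j, 1 ≤ j → j ≤ k + 1 → ∀ e, Missing c e (y j) →
      Missing (recolor (recolor c x (y 1) none) x (y 0) (some a)) e (y j) := by
    intro j h1 hj e he w hw
    have hj0 : y j ≠ y 0 := fun h => by
      have := hf.inj j 0 hj (by omega) h
      omega
    simp only [recolor] at hw
    split_ifs at hw with h h'
    · rcases h with ⟨h2, h3⟩ | ⟨h2, h3⟩
      · by_cases hj1 : j = 1
        · subst hj1; exact hx1 h2.symm
        · obtain ⟨j, rfl⟩ : ∃ i, j = i + 1 := ⟨j - 1, by omega⟩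
          obtain ⟨b, hb, -⟩ := hf.missing j (by omega)
          rw [h2, hc.irrefl] at hb
          simp at hb
      · exact hj0 h2
    · exact he w hw
  have key2 : ∀ j, 2 ≤ j → j ≤ k + 1 →
      (recolor (recolor c x (y 1) none) x (y 0) (some a)) x (y j) = c x (y j) := by
    intro j h2 hj
    have hj0 : y j ≠ y 0 := fun h => by
      have := hf.inj j 0 hj (by omega) h
      omega
    have hj1 : y j ≠ y 1 := fun h => by
      have := hf.inj j 1 hj (by omega) h
      omega
    simp [recolor, hj0, hj1, hx1, hf.ne]
  refine ⟨recolor (recolor c x (y 1) none) x (y 0) (some a), hd.recolor_some hf.ne hax hay,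
    ⟨?_, hx1, ?_, ?_⟩, ?_, ?_, key, key2⟩
  · intro i j hi hj h
    have := hf.inj (i + 1) (j + 1) (by omega) (by omega) h
    omega
  · simp [recolor, h01.symm, hf.ne]
  · intro j hj
    obtain ⟨b, hb, hbm⟩ := hf.missing (j + 1) (by omega)
    refine ⟨b, ?_, key (j + 1) (by omega) (by omega) b hbm⟩
    rw [key2 (j + 1 + 1) (by omega) (by omega), hb]
  · intro c'' h u v
    rw [h u v]
    have h3 : c (y 1) x ≠ none := by rw [hc.symm, ha]; simp
    have h4 : c x (y 1) ≠ none := by rw [ha]; simp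
    simp only [recolor]
    split_ifs with h1 h2 <;> grind
  · intro e he w hw
    simp only [recolor] at hw
    split_ifs at hw with h h'
    · simp only [Option.some.injEq] at hw
      exact he (y 1) (hw ▸ ha)
    · exact he w hw

/-- If some colour is missing at the centre and at the last vertex of a fan, the first edge of
the fan can be coloured. -/
theorem IsFan.exists_extends_of_missing {x : V} {e : C} {k : ℕ} :
    ∀ {c : V → V → Option C} {y : ℕ → V}, IsPartialEdgeColoring c → IsFan c x y k →
    Missing c e x → Missing c e (y k) →
    ∃ c', IsPartialEdgeColoring c' ∧ Extends c c' x (y 0) := by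
  classical
  induction k with
  | zero =>
    intro c y hc hf hx hy
    refine ⟨recolor c x (y 0) (some e), hc.recolor_some hf.ne hx hy, fun u v => ?_⟩
    simp only [recolor]
    split_ifs with h <;> simp [h]
  | succ k ih =>
    intro c y hc hf hx hy
    obtain ⟨c', hc', hf', hext, hmx, hmy, -⟩ := hf.shift hc
    obtain ⟨c'', h1, h2⟩ := ih hc' hf' (hmx e hx) (hmy (k + 1) (by omega) le_rfl e hy)
    exact ⟨c'', h1, hext _ h2⟩

/-- If the colour of the second edge of a fan is missing at its last vertex, the first edge can be
coloured. -/
theorem IsFan.exists_extends_of_missing_second [Finite V] (hc : IsPartialEdgeColoring c) {x : V}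
    {a b : C} {y : ℕ → V} {k : ℕ} (hf : IsFan c x y k) (hk : 1 ≤ k) (ha : Missing c a x)
    (hb : c x (y 1) = some b) (hbk : Missing c b (y k)) :
    ∃ c', IsPartialEdgeColoring c' ∧ Extends c c' x (y 0) := by
  classical
  have hb0 : Missing c b (y 0) := by
    obtain ⟨b', h1, h2⟩ := hf.missing 0 (by omega)
    simp only [zero_add] at h1
    rw [hb] at h1
    cases h1
    exact h2
  have hyx : ∀ j ≤ k, y j ≠ x := by
    intro j hj h
    rcases j with _ | j
    · exact hf.ne h.symm
    · obtain ⟨b', h1, -⟩ := hf.missing j (by omega)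
      rw [h, hc.irrefl] at h1
      simp at h1
  have hk1 : k ≠ 1 := by
    rintro rfl
    exact hbk x (by rw [hc.symm, hb])
  have h0k : y 0 ≠ y k := fun h => by
    have := hf.inj 0 k (by omega) le_rfl h
    omega
  -- The vertices `x`, `y 0`, `y k` each miss `a` or `b`, so they are ends of `a`/`b` chains and
  -- cannot all share one. The chain exchanged is one that avoids `x`: that of `y k` here, that of
  -- `y 0` in the other case.
  by_cases hr : (hc.kempeGraph a b).Reachable (y 0) x
  · have hrk : ¬ (hc.kempeGraph a b).Reachable (y k) x := fun hr' =>
      (hc.kempeGraph a b).not_reachable_of_three_ends (hc.ncard_kempeGraph_le_two a b)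
        (hyx 0 (by omega)).symm (hyx k le_rfl).symm h0k
        (hc.ncard_kempeGraph_le_one (Or.inl ha)) (hc.ncard_kempeGraph_le_one (Or.inr hb0))
        (hc.ncard_kempeGraph_le_one (Or.inr hbk)) hr.symm hr'.symm
    have hrk0 : ¬ (hc.kempeGraph a b).Reachable (y k) (y 0) := fun h => hrk (h.trans hr)
    let S : Set V := {v | (hc.kempeGraph a b).Reachable (y k) v}
    have hS := hc.kempeClosed_component a b (y k)
    have hxS : ∀ v, swapOn c a b S x v = c x v := fun v => if_neg hrk
    -- The exchange could only spoil a fan colour `a` or `b`. But `a` is missing at `x`, and `b` is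
    -- required to be missing only at `y 0`, which is off the chain.
    have hf' : IsFan (swapOn c a b S) x y k := by
      refine ⟨hf.inj, hf.ne, by rw [hxS, hf.uncolored], fun j hj => ?_⟩
      obtain ⟨e, h1, h2⟩ := hf.missing j hj
      refine ⟨e, by rw [hxS, h1], ?_⟩
      by_cases hjS : y j ∈ S
      · have hj0 : j ≠ 0 := by
          rintro rfl
          exact hrk0 hjS
        have hea : e ≠ a := by
          rintro rfl
          exact ha _ h1
        have heb : e ≠ b := by
          rintro rfl
          have := hf.inj (j + 1) 1 (by omega) (by omega) (hc.proper x _ _ _ h1 hb)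
          omega
        have := missing_swapOn_of_mem (a := a) (b := b) hjS h2
        rwa [Equiv.swap_apply_of_ne_of_ne hea heb] at this
      · exact missing_swapOn_of_notMem hjS h2
    obtain ⟨c', h1, h2⟩ := hf'.exists_extends_of_missing (e := a)
      (hc.swapOn_isPartialEdgeColoring hS) (missing_swapOn_of_notMem hrk ha)
      (missing_swapOn_of_mem_of_missing_right (Reachable.refl _) hbk)
    exact ⟨c', h1, fun u v => by rw [h2 u v, swapOn_ne_none]⟩
  · let S : Set V := {v | (hc.kempeGraph a b).Reachable (y 0) v}
    have hS := hc.kempeClosed_component a b (y 0)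
    have hf' : IsFan (swapOn c a b S) x y 0 := by
      refine ⟨fun i j hi hj _ => by omega, hf.ne, ?_, fun j hj => by omega⟩
      exact (if_neg hr).trans hf.uncolored
    obtain ⟨c', h1, h2⟩ := hf'.exists_extends_of_missing (e := a)
      (hc.swapOn_isPartialEdgeColoring hS) (missing_swapOn_of_notMem hr ha)
      (missing_swapOn_of_mem_of_missing_right (Reachable.refl _) hb0)
    exact ⟨c', h1, fun u v => by rw [h2 u v, swapOn_ne_none]⟩

/-- If the colour of some edge of a fan is missing at its last vertex, the first edge can be
coloured. -/
theorem IsFan.exists_extends_of_missing_color [Finite V] {x : V} {a b : C} {i : ℕ} :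
    ∀ {c : V → V → Option C} {y : ℕ → V} {k : ℕ}, IsPartialEdgeColoring c → IsFan c x y k →
    i + 1 ≤ k → Missing c a x → c x (y (i + 1)) = some b → Missing c b (y k) →
    ∃ c', IsPartialEdgeColoring c' ∧ Extends c c' x (y 0) := by
  -- Each shift brings the edge of colour `b` one place nearer the front, until it is the second
  -- edge.
  induction i with
  | zero => exact fun hc hf hk ha hb hbk => hf.exists_extends_of_missing_second hc hk ha hb hbk
  | succ i ih =>
    intro c y k hc hf hk ha hb hbk
    obtain ⟨k, rfl⟩ : ∃ l, k = l + 1 := ⟨k - 1, by omega⟩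
    obtain ⟨c', hc', hf', hext, hmx, hmy, hcol⟩ := hf.shift hc
    obtain ⟨c'', h1, h2⟩ := ih hc' hf' (by omega) (hmx a ha)
      (by rw [hcol (i + 1 + 1) (by omega) hk, hb]) (hmy (k + 1) (by omega) le_rfl b hbk)
    exact ⟨c'', h1, hext _ h2⟩

/-- If a colour is missing at every vertex, an uncoloured edge can be coloured. -/
theorem exists_extends [Finite V] (hc : IsPartialEdgeColoring c) (hm : ∀ v, ∃ a, Missing c a v)
    {x y₀ : V} (hxy : x ≠ y₀) (h0 : c x y₀ = none) :
    ∃ c', IsPartialEdgeColoring c' ∧ Extends c c' x y₀ := by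
  classical
  choose μ hμ using hm
  -- The fan is grown greedily: from `u`, follow the edge at `x` whose colour is the chosen missing
  -- colour of `u`. It stops when there is no such edge or a vertex repeats; the least such index
  -- keeps the fan vertices distinct.
  let next : V → V := fun u => if h : ∃ w, c x w = some (μ u) then h.choose else u
  let y : ℕ → V := fun i => next^[i] y₀
  have hnext : ∀ u, (∃ w, c x w = some (μ u)) → c x (next u) = some (μ u) := by
    intro u h
    simp only [next, dif_pos h]
    exact h.choose_spec
  have hy : ∀ i, y (i + 1) = next (y i) := fun i => Function.iterate_succ_apply' next i y₀
  have hfan : ∀ k, (∀ i j, i ≤ k → j ≤ k → y i = y j → i = j) →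
      (∀ j < k, ∃ w, c x w = some (μ (y j))) → IsFan c x y k := by
    intro k hinj hex
    refine ⟨hinj, hxy, h0, fun j hj => ⟨μ (y j), ?_, hμ _⟩⟩
    rw [hy]
    exact hnext _ (hex j hj)
  have hend : ∃ k, (¬ ∃ w, c x w = some (μ (y k))) ∨ ∃ i ≤ k, y (k + 1) = y i := by
    by_contra! hcon
    refine not_injective_infinite_finite y fun i j hij => ?_
    rcases lt_trichotomy i j with h | h | h
    · obtain ⟨j, rfl⟩ : ∃ l, j = l + 1 := ⟨j - 1, by omega⟩
      exact absurd hij.symm ((hcon j).2 i (by omega))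
    · exact h
    · obtain ⟨i, rfl⟩ : ∃ l, i = l + 1 := ⟨i - 1, by omega⟩
      exact absurd hij ((hcon i).2 j (by omega))
  have hmin := fun j => Nat.find_min hend (m := j)
  have hspec := Nat.find_spec hend
  generalize Nat.find hend = k at hmin hspec
  push Not at hmin
  have hf : IsFan c x y k := by
    refine hfan k (fun i j hi hj hij => ?_) fun j hj => (hmin j hj).1
    rcases lt_trichotomy i j with h | h | h
    · obtain ⟨j, rfl⟩ : ∃ l, j = l + 1 := ⟨j - 1, by omega⟩
      exact absurd hij.symm ((hmin j (by omega)).2 i (by omega))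
    · exact h
    · obtain ⟨i, rfl⟩ : ∃ l, i = l + 1 := ⟨i - 1, by omega⟩
      exact absurd hij ((hmin i (by omega)).2 j (by omega))
  by_cases hex : ∃ w, c x w = some (μ (y k))
  · obtain ⟨i, hi, hik⟩ := hspec.resolve_left (not_not_intro hex)
    have hcol := hnext _ hex
    rw [← hy, hik] at hcol
    rcases i with _ | i
    · rw [show y 0 = y₀ from rfl, h0] at hcol
      simp at hcol
    · exact hf.exists_extends_of_missing_color hc hi (hμ x) hcol (hμ _)
  · push Not at hex
    exact hf.exists_extends_of_missing hc hex (hμ _)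

end IsPartialEdgeColoring

open IsPartialEdgeColoring in
/-- **Vizing's theorem**: the edges of a finite simple graph in which every degree is smaller than
the number of colours have a proper colouring. -/
theorem SimpleGraph.exists_edgeColoring {V C : Type*} [Finite V] [Finite C] (G : SimpleGraph V)
    (hG : ∀ v, (G.neighborSet v).ncard < Nat.card C) :
    ∃ c : V → V → Option C, IsPartialEdgeColoring c ∧ ∀ u v, c u v ≠ none ↔ G.Adj u v := by
  classical
  let P : Set (V → V → Option C) :=
    {c | IsPartialEdgeColoring c ∧ ∀ u v, c u v ≠ none → G.Adj u v}
  have hP : P.Nonempty := ⟨fun _ _ => none, ⟨by simp, by simp, by simp⟩, by simp⟩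
  -- A partial colouring with the most coloured edges must be total, since an uncoloured edge could
  -- be added.
  obtain ⟨c, ⟨hc, hcG⟩, hmax⟩ := Set.exists_max_image P
    (fun c => {p : V × V | c p.1 p.2 ≠ none}.ncard) (Set.toFinite P) hP
  refine ⟨c, hc, fun u v => ⟨hcG u v, fun huv hnone => ?_⟩⟩
  have hm : ∀ v, ∃ a, Missing c a v := by
    intro v
    by_contra! hcon
    simp only [Missing] at hcon
    push Not at hcon
    choose w hw using hcon
    refine absurd (hG v) (not_lt.2 ?_)
    rw [← Nat.card_coe_set_eq]
    refine Nat.card_le_card_of_injective (fun a => ⟨w a, hcG v (w a) (by simp [hw])⟩) ?_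
    intro a b hab
    have h1 := hw a
    rw [show w a = w b from congrArg Subtype.val hab, hw b] at h1
    exact (Option.some.inj h1).symm
  obtain ⟨c', hc', hext⟩ := hc.exists_extends hm huv.ne hnone
  have hlt : {p : V × V | c p.1 p.2 ≠ none}.ncard < {p : V × V | c' p.1 p.2 ≠ none}.ncard := by
    refine Set.ncard_lt_ncard ⟨fun p hp => (hext _ _).2 (Or.inl hp), fun h => ?_⟩
    exact h (show (u, v) ∈ _ from (hext u v).2 (by simp)) hnone
  refine absurd (hmax c' ⟨hc', fun p q hpq => ?_⟩) (not_le.2 hlt)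
  rcases (hext p q).1 hpq with h | ⟨rfl, rfl⟩ | ⟨rfl, rfl⟩
  · exact hcG _ _ h
  · exact huv
  · exact huv.symm

end EdgeColoring

/-! ### Bipartiteness of the union of two colour classes. -/

/-- Two fixed point free involutions have a common proper colouring with two colours. -/
theorem Equiv.Perm.exists_bool_coloring_of_involutions {X : Type*} (A B : Equiv.Perm X)
    (hA : A * A = 1) (hB : B * B = 1) (hfA : ∀ x, A x ≠ x) (hfB : ∀ x, B x ≠ x) :
    ∃ χ : X → Bool, (∀ x, χ (A x) ≠ χ x) ∧ ∀ x, χ (B x) ≠ χ x := by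
  classical
  have hAA : ∀ x, A (A x) = x := fun x => congrArg (fun f : Equiv.Perm X => f x) hA
  have hBB : ∀ x, B (B x) = x := fun x => congrArg (fun f : Equiv.Perm X => f x) hB
  have hAi : A⁻¹ = A := inv_eq_of_mul_eq_one_left hA
  have hBi : B⁻¹ = B := inv_eq_of_mul_eq_one_left hB
  have hconj : ∀ i : ℤ, A * (A * B) ^ i = (A * B) ^ (-i) * A := by
    intro i
    have h1 := conj_zpow (a := A) (b := A * B) (i := i)
    have h2 : A * (A * B) * A⁻¹ = (A * B)⁻¹ := by
      rw [mul_inv_rev, hBi, ← mul_assoc A A B, hA, one_mul]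
    rw [h2, inv_zpow', hAi] at h1
    rw [h1, mul_assoc, hA, mul_one]
  -- If `(A * B) ^ j` sends `x` to `A x`, the dihedral relation makes `(A * B) ^ i` of `x` a fixed
  -- point of `A` when `j = 2i`, and of `B` when `j = 2i + 1`.
  have hne : ∀ x, ¬ (A * B).SameCycle x (A x) := by
    rintro x ⟨j, hj⟩
    rcases Int.even_or_odd' j with ⟨i, rfl | rfl⟩
    · apply hfA (((A * B) ^ i) x)
      have : A * (A * B) ^ i = (A * B) ^ (-i) * A := hconj i
      calc A (((A * B) ^ i) x) = (A * (A * B) ^ i) x := rfl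
        _ = ((A * B) ^ (-i)) (A x) := by rw [this]; rfl
        _ = ((A * B) ^ (-i) * (A * B) ^ (2 * i)) x := by rw [← hj]; rfl
        _ = ((A * B) ^ i) x := by rw [← zpow_add]; congr 2; ring
    · apply hfB (((A * B) ^ i) x)
      apply A.injective
      calc A (B (((A * B) ^ i) x)) = ((A * B) * (A * B) ^ i) x := rfl
        _ = ((A * B) ^ (-i) * (A * B) ^ (2 * i + 1)) x := by
          rw [← zpow_add, ← zpow_one_add]; congr 2; ring
        _ = ((A * B) ^ (-i)) (A x) := by rw [← hj]; rfl
        _ = (A * (A * B) ^ i) x := by rw [hconj i]; rfl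
  let s := Equiv.Perm.SameCycle.setoid (A * B)
  -- Both `A` and `B` exchange the cycle of `x` with that of `A x`; an arbitrary order selects one
  -- cycle of each pair.
  let _ : LinearOrder (Quotient s) := linearOrderOfSTO WellOrderingRel
  let q : X → Quotient s := Quotient.mk s
  have hq : ∀ x, q x ≠ q (A x) := fun x h => hne x (Quotient.exact h)
  have h1 : ∀ x, q (A (B x)) = q x := fun x => Quotient.sound ⟨-1, by simp [hAi, hBi, hAA, hBB]⟩
  have h2 : ∀ x, q (B x) = q (A x) := fun x => by
    rw [← h1 (B x), hBB]
  refine ⟨fun x => decide (q x < q (A x)), fun x h => ?_, fun x h => ?_⟩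
  · simp only [hAA, decide_eq_decide] at h
    rcases lt_or_gt_of_ne (hq x) with h' | h'
    · exact lt_asymm h' (h.2 h')
    · exact lt_asymm h' (h.1 h')
  · simp only [h1, h2, decide_eq_decide] at h
    rcases lt_or_gt_of_ne (hq x) with h' | h'
    · exact lt_asymm h' (h.2 h')
    · exact lt_asymm h' (h.1 h')

open Classical in
/-- The involution of the double cover of `V` that follows the edges of colour `a` and exchanges
the two sheets above the vertices at which `a` is missing. -/
noncomputable def colorInvolution {V C : Type*} (c : V → V → Option C) (a : C) :
    V × Bool → V × Bool :=
  fun x => if h : ∃ w, c x.1 w = some a then (h.choose, x.2) else (x.1, !x.2)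

namespace IsPartialEdgeColoring

variable {V C : Type*} {c : V → V → Option C}

theorem colorInvolution_of_eq_some (hc : IsPartialEdgeColoring c) {a : C} {v w : V}
    (h : c v w = some a) (i : Bool) : colorInvolution c a (v, i) = (w, i) := by
  have hex : ∃ w, c v w = some a := ⟨w, h⟩
  simp only [colorInvolution, dif_pos hex, Prod.mk.injEq, and_true]
  exact hc.proper v _ _ a hex.choose_spec h

theorem colorInvolution_involutive (hc : IsPartialEdgeColoring c) (a : C) :
    Function.Involutive (colorInvolution c a) := by
  rintro ⟨v, i⟩
  by_cases h : ∃ w, c v w = some a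
  · obtain ⟨w, hw⟩ := h
    rw [hc.colorInvolution_of_eq_some hw, hc.colorInvolution_of_eq_some ((hc.symm w v).trans hw)]
  · simp [colorInvolution, h]

/-- This is the purpose of the double cover: a vertex that misses the colour still moves, by
changing sheets. -/
theorem colorInvolution_ne (hc : IsPartialEdgeColoring c) (a : C) (x : V × Bool) :
    colorInvolution c a x ≠ x := by
  obtain ⟨v, i⟩ := x
  by_cases h : ∃ w, c v w = some a
  · obtain ⟨w, hw⟩ := h
    rw [hc.colorInvolution_of_eq_some hw]
    intro h
    simp only [Prod.mk.injEq, and_true] at h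
    rw [h, hc.irrefl] at hw
    simp at hw
  · simp [colorInvolution, h]

/-- The union of two colour classes is bipartite. -/
theorem exists_bool_coloring (hc : IsPartialEdgeColoring c) (a b : C) :
    ∃ χ : V → Bool, ∀ u v, c u v = some a ∨ c u v = some b → χ v = !χ u := by
  have hinv := hc.colorInvolution_involutive
  obtain ⟨χ, h1, h2⟩ := Equiv.Perm.exists_bool_coloring_of_involutions
    (hinv a).toPerm (hinv b).toPerm (Equiv.ext (hinv a)) (Equiv.ext (hinv b))
    (hc.colorInvolution_ne a) (hc.colorInvolution_ne b)
  -- Coloured edges stay within a sheet, so one sheet suffices.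
  refine ⟨fun v => χ (v, false), fun u v huv => ?_⟩
  rw [Bool.eq_not]
  rcases huv with h | h
  · have := h1 (u, false)
    rwa [Function.Involutive.coe_toPerm, hc.colorInvolution_of_eq_some h] at this
  · have := h2 (u, false)
    rwa [Function.Involutive.coe_toPerm, hc.colorInvolution_of_eq_some h] at this

end IsPartialEdgeColoring

/-! ### Adjacency types, and colourings turned into `(m, n)`-graphs. -/

namespace AdjType

variable {m n : ℕ}

/-- The adjacency types are two copies of the arc labels and one copy of the edge labels. -/
def equivSum (m n : ℕ) : AdjType m n ≃ (Fin m ⊕ Fin m) ⊕ Fin n where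
  toFun
    | fwd k => .inl (.inl k)
    | bwd k => .inl (.inr k)
    | edge k => .inr k
  invFun
    | .inl (.inl k) => fwd k
    | .inl (.inr k) => bwd k
    | .inr k => edge k
  left_inv a := by cases a <;> rfl
  right_inv a := by rcases a with (k | k) | k <;> rfl

instance : Finite (AdjType m n) := Finite.of_equiv _ (equivSum m n).symm

theorem card (m n : ℕ) : Nat.card (AdjType m n) = 2 * m + n := by
  rw [Nat.card_congr (equivSum m n)]
  simp [two_mul]

@[simp] theorem rev_rev (a : AdjType m n) : a.rev.rev = a := by cases a <;> rfl

theorem rev_injective : Function.Injective (rev : AdjType m n → AdjType m n) :=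
  Function.LeftInverse.injective rev_rev

/-- Reverse the arc types whose label is selected by `p`. -/
def reverseIf (p : Fin m → Bool) : AdjType m n → AdjType m n
  | fwd k => if p k then fwd k else bwd k
  | bwd k => if p k then bwd k else fwd k
  | edge k => edge k

theorem reverseIf_injective (p : Fin m → Bool) :
    Function.Injective (reverseIf p : AdjType m n → AdjType m n) := by
  intro a b h
  cases a <;> cases b <;> simp only [reverseIf] at h <;> grind

end AdjType

namespace MNGraph

variable {m n : ℕ}

theorem σ_eq_some_rev {V : Type*} (G : MNGraph m n V) {u v : V} {a : AdjType m n}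
    (h : G.σ u v = some a) : G.σ v u = some a.rev := by
  rw [G.σ_rev u v, h]; rfl

/-- Every finite simple graph of maximum degree less than `2m + n` underlies an `(m, n)`-graph in
which the adjacency types at each vertex are distinct. -/
theorem exists_und_eq_of_degree_lt {V : Type*} [Finite V] (U : SimpleGraph V)
    (hU : ∀ v, (U.neighborSet v).ncard < 2 * m + n) :
    ∃ G : MNGraph m n V, G.und = U ∧
      ∀ u v w a, G.σ u v = some a → G.σ u w = some a → v = w := by
  obtain ⟨c, hc, hcU⟩ := U.exists_edgeColoring (C := AdjType m n)
    (by simpa only [AdjType.card] using hU)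
  -- An edge of an arc colour must be read with opposite types from its two ends. Its ends lie on
  -- opposite sides of `χ k`, so reversing the type on one side only achieves this.
  choose χ hχ using fun k : Fin m => hc.exists_bool_coloring (.fwd k) (.bwd k)
  refine ⟨⟨fun u v => (c u v).map (AdjType.reverseIf fun k => χ k u), fun v => ?_,
    fun u v => ?_⟩, ?_, fun u v w a h1 h2 => ?_⟩
  · simp [hc.irrefl]
  · rw [hc.symm v u]
    rcases h : c u v with _ | (k | k | k)
    · rfl
    · have := hχ k u v (Or.inl h)
      cases h' : χ k u <;> simp [AdjType.reverseIf, AdjType.rev, this, h']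
    · have := hχ k u v (Or.inr h)
      cases h' : χ k u <;> simp [AdjType.reverseIf, AdjType.rev, this, h']
    · rfl
  · ext u v
    rw [← hcU u v]
    simp [und]
  · simp only [Option.map_eq_some_iff] at h1 h2
    obtain ⟨p, hp, rfl⟩ := h1
    obtain ⟨q, hq, hqp⟩ := h2
    obtain rfl := AdjType.reverseIf_injective _ hqp
    exact hc.proper u v w _ hp hq

-- Relative and absolute cliques through distinguished pairs.

universe u

/-- The vertices `u` and `v` are adjacent, or have a common neighbour at which their types
differ. -/
def Distinguished {V : Type u} (G : MNGraph m n V) (u v : V) : Prop :=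
  G.und.Adj u v ∨ ∃ w a b, G.σ w u = some a ∧ G.σ w v = some b ∧ a ≠ b

theorem Distinguished.map_ne {V : Type u} {G : MNGraph m n V} {u v : V} (h : G.Distinguished u v)
    {W : Type*} {H : MNGraph m n W} {f : V → W} (hf : G.IsHom H f) : f u ≠ f v := by
  intro huv
  rcases h with h | ⟨w, a, b, ha, hb, hab⟩
  · obtain ⟨a, ha⟩ := Option.ne_none_iff_exists'.1 h
    have := hf _ _ _ ha
    rw [huv, H.σ_self] at this
    simp at this
  · have h1 := hf _ _ _ ha
    rw [huv, hf _ _ _ hb] at h1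
    exact hab (Option.some.inj h1).symm

/-- Two vertices that are not distinguished can be identified by a homomorphism. -/
theorem exists_isHom_of_not_distinguished {V : Type u} (G : MNGraph m n V) {u v : V} (huv : u ≠ v)
    (h : ¬ G.Distinguished u v) :
    ∃ (H : MNGraph m n V) (f : V → V), G.IsHom H f ∧ f u = f v := by
  classical
  simp only [Distinguished, not_or, not_exists, not_and, not_not] at h
  obtain ⟨hadj, hsp⟩ := h
  have huv0 : G.σ u v = none := not_not.1 hadj
  have hvu0 : G.σ v u = none := by rw [G.σ_rev u v, huv0]; rfl
  have hsp' : ∀ w a b, G.σ u w = some a → G.σ v w = some b → a = b := fun w a b ha hb =>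
    AdjType.rev_injective (hsp w _ _ (G.σ_eq_some_rev ha) (G.σ_eq_some_rev hb))
  -- The vertex `u` inherits the adjacencies of `v`, and `v` stays as an isolated vertex so that the
  -- vertex set is unchanged. By `hsp'`, the two sides of `or` agree when both are present.
  let H : MNGraph m n V :=
    { σ := fun x y => if x = v ∨ y = v then none else if x = u then (G.σ u y).or (G.σ v y)
        else if y = u then (G.σ x u).or (G.σ x v) else G.σ x y
      σ_self := fun x => by
        split_ifs with h1 h2
        · rfl
        · subst h2; simp [G.σ_self, hvu0]
        · exact G.σ_self x
      σ_rev := fun x y => by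
        by_cases hx : x = v
        · simp [hx]
        by_cases hy : y = v
        · simp [hy]
        by_cases hxu : x = u <;> by_cases hyu : y = u
        · subst hxu hyu; simp [huv, G.σ_self, hvu0]
        · subst hxu
          simp only [hx, hy, hyu, or_self, if_false, if_true]
          rw [G.σ_rev x y, G.σ_rev v y]
          cases G.σ x y <;> cases G.σ v y <;> rfl
        · subst hyu
          simp only [hx, hy, hxu, or_self, if_false, if_true]
          rw [G.σ_rev x y, G.σ_rev x v]
          cases G.σ x y <;> cases G.σ x v <;> rfl
        · simp [hx, hy, hxu, hyu, G.σ_rev x y] }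
  refine ⟨H, fun x => if x = v then u else x, fun p q a ha => ?_, by simp [huv]⟩
  have hpq : p ≠ q := by
    rintro rfl
    rw [G.σ_self] at ha
    simp at ha
  by_cases hp : p = v
  · subst hp
    have hqu : q ≠ u := by rintro rfl; simp [hvu0] at ha
    simp only [H, hpq.symm, huv, if_true, if_false, or_self]
    rcases hb : G.σ u q with _ | b
    · simpa using ha
    · rw [hsp' q b a hb ha]; rfl
  by_cases hq : q = v
  · subst hq
    have hpu : p ≠ u := by rintro rfl; simp [huv0] at ha
    simp only [H, hp, huv, hpu, if_true, if_false, or_self]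
    rcases hb : G.σ p u with _ | b
    · simpa using ha
    · rw [hsp p b a hb ha]; rfl
  simp only [H, hp, hq, if_false, or_self]
  split_ifs with h1 h2
  · subst h1; simp [ha]
  · subst h2; simp [ha]
  · exact ha

theorem isRelativeClique_iff {V : Type u} (G : MNGraph m n V) (R : Set V) :
    G.IsRelativeClique R ↔ ∀ u ∈ R, ∀ v ∈ R, u ≠ v → G.Distinguished u v := by
  refine ⟨fun h u hu v hv huv => ?_, fun h W H f hf u hu v hv huv => (h u hu v hv huv).map_ne hf⟩
  by_contra hd
  obtain ⟨H, f, hf, hfuv⟩ := G.exists_isHom_of_not_distinguished huv hd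
  exact h V H f hf u hu v hv huv hfuv

/-- The subgraph induced on a set of vertices. -/
def induce {V : Type*} (G : MNGraph m n V) (S : Set V) : MNGraph m n S where
  σ u v := G.σ u v
  σ_self v := G.σ_self v
  σ_rev u v := G.σ_rev u v

theorem chromaticNumber_le {V W : Type u} {G : MNGraph m n V} {H : MNGraph m n W} {f : V → W}
    (hf : G.IsHom H f) : G.chromaticNumber ≤ ENat.card W :=
  (iInf_le _ W).trans ((iInf_le _ H).trans (iInf_le _ ⟨f, hf⟩))

/-- A non-injective homomorphism, restricted to its image, would reach a target with fewer vertices.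
If all homomorphisms are injective, no target is smaller than `A`, and the identity attains
equality. -/
theorem isAbsoluteClique_iff {V : Type u} [Finite V] (A : MNGraph m n V) :
    A.IsAbsoluteClique ↔ A.IsRelativeClique Set.univ := by
  constructor
  · intro h W H f hf u _ v _ huv hfuv
    have hf' : A.IsHom (H.induce (Set.range f)) (Set.rangeFactorization f) :=
      fun x y a ha => hf x y a ha
    have hle := chromaticNumber_le hf'
    rw [h, ENat.card_coe_set_eq, ← (Set.finite_range f).cast_ncard_eq, ENat.card_eq_coe_natCard,
      Nat.cast_le, ← Set.image_univ, ← Set.ncard_univ] at hle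
    have hinj := Set.injOn_of_ncard_image_eq (le_antisymm (Set.ncard_image_le Set.finite_univ) hle)
      Set.finite_univ
    exact huv (hinj (Set.mem_univ u) (Set.mem_univ v) hfuv)
  · intro h
    refine le_antisymm (chromaticNumber_le (f := id) fun u v a ha => ha) ?_
    refine le_iInf fun W => le_iInf fun H => le_iInf fun ⟨f, hf⟩ => ?_
    refine ENat.card_le_card_of_injective (f := f) fun u v huv => ?_
    by_contra hne
    exact h W H f hf u trivial v trivial hne huv

theorem IsAbsoluteClique.isRelativeClique {V : Type u} [Finite V] {G : MNGraph m n V} {S : Set V}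
    {A : MNGraph m n S} (hAG : A.IsSubgraph G) (hA : A.IsAbsoluteClique) :
    G.IsRelativeClique S := by
  intro W H f hf u hu v hv huv
  exact A.isAbsoluteClique_iff.1 hA W H (fun x => f x) (fun x y a ha => hf _ _ _ (hAG x y a ha))
    ⟨u, hu⟩ trivial ⟨v, hv⟩ trivial (by simpa using huv)

theorem absoluteCliqueNumber_le_relativeCliqueNumber {V : Type u} [Finite V]
    (G : MNGraph m n V) : G.absoluteCliqueNumber ≤ G.relativeCliqueNumber :=
  iSup_le fun S => iSup_le fun _ => iSup_le fun hAG => iSup_le fun hA =>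
    le_iSup₂_of_le S (hA.isRelativeClique hAG) le_rfl

/-- A relative clique in a graph of maximum degree `Δ` lies in a ball of radius two. -/
theorem IsRelativeClique.ncard_le {V : Type u} [Finite V] {G : MNGraph m n V} {R : Set V}
    (hR : G.IsRelativeClique R) {Δ : ℕ} (hΔ : ∀ v, (G.und.neighborSet v).ncard ≤ Δ) :
    R.ncard ≤ Δ ^ 2 + 1 := by
  classical
  have := Fintype.ofFinite V
  rw [isRelativeClique_iff] at hR
  rcases R.eq_empty_or_nonempty with rfl | ⟨u, hu⟩
  · simp
  let N : V → Finset V := fun v => (G.und.neighborSet v).toFinset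
  have hN : ∀ v, (N v).card ≤ Δ := fun v => by
    rw [← Set.ncard_eq_toFinset_card']; exact hΔ v
  -- Erasing `u` from each second neighbourhood leaves `Δ - 1` vertices, which brings `Δ² + Δ + 1`
  -- down to `Δ² + 1`.
  let B : Finset V := insert u (N u ∪ (N u).biUnion fun w => (N w).erase u)
  have hsub : R ⊆ B := by
    intro v hv
    by_cases huv : u = v
    · simp [B, huv]
    rcases hR u hu v hv huv with h | ⟨w, a, b, ha, hb, hab⟩
    · simp [B, N, h]
    · have h1 : G.und.Adj u w := by
        simp [und, G.σ_eq_some_rev ha]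
      have h2 : G.und.Adj w v := by simp [und, hb]
      simp only [B, N, Finset.coe_insert, Finset.coe_union, Set.mem_insert_iff, Set.mem_union,
        Finset.mem_coe, Finset.mem_biUnion, Set.mem_toFinset, SimpleGraph.mem_neighborSet,
        Finset.mem_erase]
      exact Or.inr (Or.inr ⟨w, h1, Ne.symm huv, h2⟩)
  have hB : B.card ≤ 1 + (Δ + Δ * (Δ - 1)) := by
    refine (Finset.card_insert_le _ _).trans ?_
    rw [add_comm]
    refine Nat.add_le_add_left ((Finset.card_union_le _ _).trans (Nat.add_le_add (hN u) ?_)) 1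
    refine (Finset.card_biUnion_le_card_mul _ _ (Δ - 1) fun w hw => ?_).trans
      (Nat.mul_le_mul_right _ (hN u))
    rw [Finset.card_erase_of_mem]
    · exact Nat.sub_le_sub_right (hN w) 1
    · simpa [N] using (show G.und.Adj u w by simpa [N] using hw).symm
  calc R.ncard ≤ (B : Set V).ncard := Set.ncard_le_ncard hsub
    _ = B.card := Set.ncard_coe_finset B
    _ ≤ _ := hB
    _ = Δ ^ 2 + 1 := by
      rcases Δ with _ | d
      · rfl
      · simp only [Nat.add_sub_cancel]; ring

end MNGraph

/-! ### Counting separated pairs. -/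

/-- The number of pairs that a colouring with `p` colours of a set of `d` elements separates is at
most `(1 - 1 / p) d ^ 2`. -/
theorem Finset.card_mul_card_separated_le {α κ : Type*} [DecidableEq κ] [Fintype κ] (D : Finset α)
    (t : α → κ) :
    Fintype.card κ * ((D ×ˢ D).filter fun x => t x.1 ≠ t x.2).card ≤
      (Fintype.card κ - 1) * D.card ^ 2 := by
  classical
  have h1 : D.card = ∑ k : κ, (D.filter fun x => t x = k).card :=
    Finset.card_eq_sum_card_fiberwise fun _ _ => Finset.mem_univ _
  have h2 : ((D ×ˢ D).filter fun x => t x.1 = t x.2).card =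
      ∑ k : κ, (D.filter fun x => t x = k).card ^ 2 := by
    rw [Finset.card_eq_sum_card_fiberwise (f := fun x => t x.1) (t := Finset.univ)
      fun _ _ => Finset.mem_univ _]
    refine Finset.sum_congr rfl fun k _ => ?_
    rw [sq, ← Finset.card_product]
    congr 1
    ext ⟨x, y⟩
    simp only [Finset.mem_filter, Finset.mem_product]
    grind
  have h3 := Finset.card_filter_add_card_filter_not (s := D ×ˢ D) (fun x => t x.1 = t x.2)
  -- Cauchy–Schwarz: the monochromatic pairs are at least a `1 / p` share of all pairs.
  have h4 : D.card ^ 2 ≤ Fintype.card κ * ∑ k : κ, (D.filter fun x => t x = k).card ^ 2 := by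
    rw [h1]
    exact sq_sum_le_card_mul_sum_sq
  rw [h2, Finset.card_product] at h3
  rw [Nat.sub_mul, one_mul]
  apply Nat.le_sub_of_add_le
  calc _ ≤ Fintype.card κ * ((D ×ˢ D).filter fun x => ¬ t x.1 = t x.2).card +
        Fintype.card κ * ∑ k : κ, (D.filter fun x => t x = k).card ^ 2 := Nat.add_le_add_left h4 _
    _ = _ := by rw [← mul_add, add_comm, h3, sq]

namespace MNGraph

variable {m n : ℕ}
universe u

/-- Counting the pairs of a relative clique by the vertices that distinguish them. -/
theorem IsRelativeClique.mul_ncard_le {V : Type u} [Finite V] {G : MNGraph m n V} {R : Set V}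
    (hR : G.IsRelativeClique R) (hne : R.Nonempty) {Δ : ℕ}
    (hΔ : ∀ v, (G.und.neighborSet v).ncard ≤ Δ) :
    (2 * m + n) * (R.ncard - 1) ≤ (2 * m + n) * Δ + (2 * m + n - 1) * Δ ^ 2 := by
  classical
  have := Fintype.ofFinite V
  have := Fintype.ofFinite (AdjType m n)
  rw [isRelativeClique_iff] at hR
  rw [← AdjType.card, Nat.card_eq_fintype_card]
  set p := Fintype.card (AdjType m n) with hp
  let S : Finset V := R.toFinset
  have hS : R.ncard = S.card := Set.ncard_eq_toFinset_card' R
  let N : V → Finset V := fun v => (G.und.neighborSet v).toFinset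
  have hN : ∀ v, (N v).card ≤ Δ := fun v => by
    rw [← Set.ncard_eq_toFinset_card']; exact hΔ v
  have hNmem : ∀ v w, w ∈ N v ↔ G.und.Adj v w := fun v w => by simp [N]
  let D : V → Finset V := fun w => S.filter fun v => v ∈ N w
  let P : V → Finset (V × V) := fun w =>
    (D w ×ˢ D w).filter fun x => G.σ w x.1 ≠ G.σ w x.2
  have hD : ∀ w, (D w).card ≤ Δ := fun w =>
    (Finset.card_le_card fun v hv => (Finset.mem_filter.1 hv).2).trans (hN w)
  have hsum : ∑ w, (D w).card ≤ S.card * Δ := by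
    have h1 : ∑ w, (D w).card = ∑ v ∈ S, (N v).card := by
      simp only [D, Finset.card_filter]
      rw [Finset.sum_comm]
      refine Finset.sum_congr rfl fun v _ => ?_
      rw [← Finset.card_filter]
      congr 1
      ext w
      simp [hNmem, G.und.adj_comm]
    rw [h1]
    exact Finset.sum_le_card_nsmul _ _ _ fun v _ => hN v
  have hP : ∀ w, p * (P w).card ≤ (p - 1) * (D w).card ^ 2 := by
    intro w
    rcases isEmpty_or_nonempty (AdjType m n) with hemp | ⟨⟨a₀⟩⟩
    · simp [hp]
    -- The default is never used on `D w`, whose members are all neighbours of `w`.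
    · let t : V → AdjType m n := fun v => (G.σ w v).getD a₀
      refine (Nat.mul_le_mul_left _ (Finset.card_le_card fun x hx => ?_)).trans
        (Finset.card_mul_card_separated_le (D w) t)
      obtain ⟨h1, h2⟩ := Finset.mem_filter.1 hx
      refine Finset.mem_filter.2 ⟨h1, fun h3 => h2 ?_⟩
      obtain ⟨h4, h5⟩ := Finset.mem_product.1 h1
      obtain ⟨a, ha⟩ := Option.ne_none_iff_exists'.1
        ((hNmem _ _).1 (Finset.mem_filter.1 h4).2)
      obtain ⟨b, hb⟩ := Option.ne_none_iff_exists'.1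
        ((hNmem _ _).1 (Finset.mem_filter.1 h5).2)
      simp only [t, ha, hb, Option.getD_some] at h3
      rw [ha, hb, h3]
  have hoff : S.card * S.card - S.card ≤ S.card * Δ + ∑ w, (P w).card := by
    rw [← Finset.offDiag_card]
    have hsub : S.offDiag ⊆ (S.biUnion fun v => (N v).image (Prod.mk v)) ∪
        Finset.univ.biUnion P := by
      rintro ⟨u, v⟩ huv
      obtain ⟨hu, hv, hne⟩ := Finset.mem_offDiag.1 huv
      rcases hR u (Set.mem_toFinset.1 hu) v (Set.mem_toFinset.1 hv) hne with
        h | ⟨w, a, b, ha, hb, hab⟩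
      · exact Finset.mem_union_left _ (Finset.mem_biUnion.2
          ⟨u, hu, Finset.mem_image_of_mem _ ((hNmem u v).2 h)⟩)
      · have h1 : u ∈ D w := Finset.mem_filter.2 ⟨hu, (hNmem w u).2 (by simp [und, ha])⟩
        have h2 : v ∈ D w := Finset.mem_filter.2 ⟨hv, (hNmem w v).2 (by simp [und, hb])⟩
        refine Finset.mem_union_right _ (Finset.mem_biUnion.2 ⟨w, Finset.mem_univ w,
          Finset.mem_filter.2 ⟨Finset.mk_mem_product h1 h2, ?_⟩⟩)
        simpa [ha, hb] using hab
    refine (Finset.card_le_card hsub).trans ((Finset.card_union_le _ _).trans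
      (Nat.add_le_add ?_ Finset.card_biUnion_le))
    exact Finset.card_biUnion_le_card_mul _ _ _ fun v _ => Finset.card_image_le.trans (hN v)
  have hpos : 0 < S.card := by
    rw [← hS]; exact (Set.ncard_pos).2 hne
  -- One factor of `(D w).card ^ 2` is bounded by `Δ`, the other is summed by double counting. The
  -- resulting factor `S.card` cancels at the end.
  have hPsum : p * ∑ w, (P w).card ≤ (p - 1) * Δ * (S.card * Δ) := by
    calc p * ∑ w, (P w).card = ∑ w, p * (P w).card := Finset.mul_sum _ _ _
      _ ≤ ∑ w, (p - 1) * Δ * (D w).card := by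
        refine Finset.sum_le_sum fun w _ => (hP w).trans ?_
        rw [mul_assoc, sq]
        exact Nat.mul_le_mul_left _ (Nat.mul_le_mul_right _ (hD w))
      _ = (p - 1) * Δ * ∑ w, (D w).card := (Finset.mul_sum _ _ _).symm
      _ ≤ _ := Nat.mul_le_mul_left _ hsum
  rw [hS]
  refine Nat.le_of_mul_le_mul_left ?_ hpos
  calc S.card * (p * (S.card - 1)) = p * (S.card * S.card - S.card) := by
        rw [mul_left_comm, Nat.mul_sub, mul_one]
    _ ≤ p * (S.card * Δ + ∑ w, (P w).card) := Nat.mul_le_mul_left _ hoff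
    _ = p * (S.card * Δ) + p * ∑ w, (P w).card := mul_add _ _ _
    _ ≤ p * (S.card * Δ) + (p - 1) * Δ * (S.card * Δ) := Nat.add_le_add_left hPsum _
    _ = _ := by ring

end MNGraph

/-! ### Diameter two, and the passage to families. -/

theorem BoundedDegree.ncard_le {Δ : ℕ} {V : Type} [Finite V] {U : SimpleGraph V}
    (h : BoundedDegree Δ V U) (v : V) : (U.neighborSet v).ncard ≤ Δ := by
  have := h v
  rwa [← (Set.toFinite _).cast_ncard_eq, Nat.cast_le] at this

/-- A graph has diameter at most two if and only if any two distinct vertices are adjacent or have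
a common neighbour. -/
theorem SimpleGraph.ediam_le_two_iff {V : Type*} (U : SimpleGraph V) :
    U.ediam ≤ 2 ↔ ∀ u v, u ≠ v → U.Adj u v ∨ ∃ w, U.Adj w u ∧ U.Adj w v := by
  rw [SimpleGraph.ediam_le_iff]
  constructor
  · intro h u v huv
    have hle := h u v
    obtain ⟨p, hp⟩ := SimpleGraph.exists_walk_of_edist_ne_top
      (ne_top_of_le_ne_top (by simp) hle)
    rw [← hp] at hle
    have hlen : p.length ≤ 2 := by exact_mod_cast hle
    match p, hlen with
    | .nil, _ => exact absurd rfl huv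
    | .cons h₁ .nil, _ => exact Or.inl h₁
    | .cons h₁ (.cons h₂ .nil), _ => exact Or.inr ⟨_, h₁.symm, h₂⟩
    | .cons _ (.cons _ (.cons _ _)), hl => simp at hl
  · intro h u v
    by_cases huv : u = v
    · subst huv; simp
    rcases h u v huv with h | ⟨w, hu, hv⟩
    · exact (SimpleGraph.Walk.edist_le (.cons h .nil)).trans (by norm_num)
    · exact (SimpleGraph.Walk.edist_le (.cons hu.symm (.cons hv .nil))).trans (by norm_num)

namespace MNGraph

variable {m n : ℕ}

/-- An absolute clique has diameter at most two. -/
theorem IsAbsoluteClique.ediam_le_two {V : Type*} [Finite V] {A : MNGraph m n V}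
    (hA : A.IsAbsoluteClique) : A.und.ediam ≤ 2 := by
  rw [isAbsoluteClique_iff, isRelativeClique_iff] at hA
  refine A.und.ediam_le_two_iff.2 fun u v huv => ?_
  rcases hA u trivial v trivial huv with h | ⟨w, a, b, ha, hb, -⟩
  · exact Or.inl h
  · exact Or.inr ⟨w, by simp [und, ha], by simp [und, hb]⟩

theorem IsSubgraph.boundedDegree {Δ : ℕ} {V : Type} {S : Set V} {A : MNGraph m n S}
    {G : MNGraph m n V} (hAG : A.IsSubgraph G) (hG : BoundedDegree Δ V G.und) :
    BoundedDegree Δ S A.und := by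
  intro v
  refine le_trans ?_ (hG v)
  rw [← Subtype.val_injective.encard_image]
  refine Set.encard_le_encard ?_
  rintro _ ⟨w, hw, rfl⟩
  obtain ⟨a, ha⟩ := Option.ne_none_iff_exists'.1 hw
  exact Option.ne_none_iff_exists'.2 ⟨a, hAG v w a ha⟩

end MNGraph

theorem familyRelativeCliqueNumber_le {m n Δ N : ℕ}
    (h : ∀ (V : Type) (_ : Finite V) (G : MNGraph m n V) (R : Set V),
      (∀ v, (G.und.neighborSet v).ncard ≤ Δ) → G.IsRelativeClique R → R.ncard ≤ N) :
    familyRelativeCliqueNumber m n (BoundedDegree Δ) ≤ (N : ℕ∞) := by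
  refine iSup_le fun V => iSup_le fun _ => iSup_le fun G => iSup_le fun hG => iSup_le fun R =>
    iSup_le fun hR => ?_
  rw [← (Set.toFinite R).cast_ncard_eq, Nat.cast_le]
  exact h V inferInstance G R hG.ncard_le hR

theorem familyAbsoluteCliqueNumber_le_familyRelativeCliqueNumber (m n : ℕ)
    (F : (V : Type) → SimpleGraph V → Prop) :
    familyAbsoluteCliqueNumber m n F ≤ familyRelativeCliqueNumber m n F :=
  iSup_mono fun _ => iSup_mono fun _ => iSup_mono fun G => iSup_mono fun _ =>
    G.absoluteCliqueNumber_le_relativeCliqueNumber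

/-- The clique itself, not the ambient graph, is the competitor for `degreeDiameter`: its own
diameter is at most two and it inherits the degree bound. -/
theorem familyAbsoluteCliqueNumber_le_degreeDiameter (m n Δ : ℕ) :
    familyAbsoluteCliqueNumber m n (BoundedDegree Δ) ≤ degreeDiameter 2 Δ := by
  refine iSup_le fun V => iSup_le fun _ => iSup_le fun G => iSup_le fun hG => iSup_le fun S =>
    iSup_le fun A => iSup_le fun hAG => iSup_le fun hA => ?_
  rw [← ENat.card_coe_set_eq]
  exact le_iSup_of_le S (le_iSup_of_le inferInstance (le_iSup_of_le A.und
    (le_iSup_of_le (hAG.boundedDegree hG) (le_iSup_of_le hA.ediam_le_two le_rfl))))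

theorem degreeDiameter_le_familyAbsoluteCliqueNumber {m n Δ : ℕ} (h : Δ < 2 * m + n) :
    degreeDiameter 2 Δ ≤ familyAbsoluteCliqueNumber m n (BoundedDegree Δ) := by
  refine iSup_le fun V => iSup_le fun _ => iSup_le fun U => iSup_le fun hU => iSup_le fun hd => ?_
  obtain ⟨G, rfl, hG⟩ := MNGraph.exists_und_eq_of_degree_lt (m := m) (n := n) U
    fun v => (hU.ncard_le v).trans_lt h
  -- Absolute cliques are sought on subsets of `V`, so `G` enters as its copy on `Set.univ`.
  have hA : (G.induce Set.univ).IsAbsoluteClique := by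
    rw [MNGraph.isAbsoluteClique_iff, MNGraph.isRelativeClique_iff]
    rintro ⟨u, hu⟩ - ⟨v, hv⟩ - huv
    have huv' : u ≠ v := by simpa using huv
    rcases G.und.ediam_le_two_iff.1 hd u v huv' with h | ⟨w, hwu, hwv⟩
    · exact Or.inl h
    · obtain ⟨a, ha⟩ := Option.ne_none_iff_exists'.1 hwu
      obtain ⟨b, hb⟩ := Option.ne_none_iff_exists'.1 hwv
      refine Or.inr ⟨⟨w, trivial⟩, a, b, ha, hb, ?_⟩
      rintro rfl
      exact huv' (hG w u v a ha hb)
  rw [← Set.encard_univ]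
  exact le_iSup_of_le V (le_iSup_of_le inferInstance (le_iSup_of_le G (le_iSup_of_le hU
    (le_iSup_of_le Set.univ (le_iSup_of_le (G.induce Set.univ) (le_iSup_of_le
      (fun _ _ _ h => h) (le_iSup_of_le hA le_rfl)))))))

theorem mainTheorem3 (m n Δ : ℕ) (hmn : (m, n) ≠ (0, 1)) :
    familyRelativeCliqueNumber m n (BoundedDegree Δ) ≤ ((Δ ^ 2 + 1 : ℕ) : ℕ∞) ∧
    (Δ < 2 * m + n →
      degreeDiameter 2 Δ = familyAbsoluteCliqueNumber m n (BoundedDegree Δ) ∧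
      familyAbsoluteCliqueNumber m n (BoundedDegree Δ) ≤
        familyRelativeCliqueNumber m n (BoundedDegree Δ) ∧
      familyRelativeCliqueNumber m n (BoundedDegree Δ) ≤ ((Δ ^ 2 + 1 : ℕ) : ℕ∞)) ∧
    (Δ = 2 * m + n →
      familyAbsoluteCliqueNumber m n (BoundedDegree Δ) ≤
        familyRelativeCliqueNumber m n (BoundedDegree Δ) ∧
      familyRelativeCliqueNumber m n (BoundedDegree Δ) ≤ ((Δ ^ 2 + 1 : ℕ) : ℕ∞)) ∧
    (0 < 2 * m + n → 2 * m + n < Δ →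
      familyAbsoluteCliqueNumber m n (BoundedDegree Δ) ≤
        familyRelativeCliqueNumber m n (BoundedDegree Δ) ∧
      familyRelativeCliqueNumber m n (BoundedDegree Δ) ≤
        ((⌊((2 * m + n - 1 : ℚ) / (2 * m + n)) * (Δ : ℚ) ^ 2⌋₊ + Δ + 1 : ℕ) : ℕ∞)) := by
  have h1 : familyRelativeCliqueNumber m n (BoundedDegree Δ) ≤ ((Δ ^ 2 + 1 : ℕ) : ℕ∞) :=
    familyRelativeCliqueNumber_le fun _ _ _ _ hΔ hR => hR.ncard_le hΔ
  have h2 := familyAbsoluteCliqueNumber_le_familyRelativeCliqueNumber m n (BoundedDegree Δ)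
  refine ⟨h1, fun h => ⟨?_, h2, h1⟩, fun _ => ⟨h2, h1⟩, fun hp _ => ⟨h2, ?_⟩⟩
  · exact le_antisymm (degreeDiameter_le_familyAbsoluteCliqueNumber h)
      (familyAbsoluteCliqueNumber_le_degreeDiameter m n Δ)
  · refine familyRelativeCliqueNumber_le fun V _ G R hΔ hR => ?_
    rcases R.eq_empty_or_nonempty with rfl | hne
    · simp
    have hle := hR.mul_ncard_le hne hΔ
    -- Truncated subtraction is harmless: for `R.ncard ≤ Δ + 1` it gives `r = 0`, and the bound is
    -- then trivial.
    obtain ⟨r, hr⟩ : ∃ r, r = R.ncard - 1 - Δ := ⟨_, rfl⟩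
    suffices r ≤ ⌊((2 * m + n - 1 : ℚ) / (2 * m + n)) * (Δ : ℚ) ^ 2⌋₊ by omega
    refine Nat.le_floor ?_
    have hpq : (0 : ℚ) < 2 * m + n := by exact_mod_cast hp
    rw [div_mul_eq_mul_div, le_div_iff₀ hpq]
    have hr' : (2 * m + n) * r ≤ (2 * m + n - 1) * Δ ^ 2 := by
      rw [hr, Nat.mul_sub]
      exact Nat.sub_le_iff_le_add'.2 hle
    have hcast : ((2 * m + n - 1 : ℕ) : ℚ) = 2 * m + n - 1 := by
      rw [Nat.cast_sub hp]; push_cast; ring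
    have hr'' : ((2 * m + n : ℕ) : ℚ) * r ≤ ((2 * m + n - 1 : ℕ) : ℚ) * (Δ : ℚ) ^ 2 := by
      exact_mod_cast hr'
    rw [hcast] at hr''
    push_cast at hr''
    linarith
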